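/- Let $\mathfrak c = 2^{\aleph_0}$ and let $\eta$ be the Euclidean topology on $\mathbb R$. For a topology $\tau$ on $\mathbb R$ let $\Gamma(\tau)$ be the set of all $x\in\mathbb R$ at which the neighborhood filters of $x$ with respect to $\eta$ and to $\tau$ are different. Then there is a family $\mathcal F$ of topologies on $\mathbb R$ with $|\mathcal F| = 2^{\mathfrak c}$ such that every $\tau\in\mathcal F$ is finer than $\eta$ and satisfies $\Gamma(\tau)=\mathbb R$, every space $(\mathbb R,\tau)$ with $\tau\in\mathcal F$ is connected, separable and metrizable, and the spaces $(\mathbb R,\tau)$, $\tau\in\mathcal F$, are incomparable in the following sense: if $\sigma,\tau\in\mathcal F$ and $(\mathbb R,\sigma)$ is homeomorphic to the subspace $S\subseteq\mathbb R$ of $(\mathbb R,\tau)$, then $\sigma=\tau$ and $S=\mathbb R$. (That is, the spaces are mutually non-homeomorphic and none is homeomorphic to a proper subspace of itself or of another one.) -/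

import Mathlib

open scoped Topology

/-- The Euclidean topology `η` on the real line. -/
abbrev euclideanTopology : TopologicalSpace ℝ := inferInstance

/-- `τ` is finer than (or equal to) the Euclidean topology: Euclidean open sets are `τ`-open. -/
def RefinesEuclidean (τ : TopologicalSpace ℝ) : Prop :=
  ∀ U : Set ℝ, IsOpen[euclideanTopology] U → IsOpen[τ] U

/-- `Γ(τ)`: the points at which the neighborhood filters of `η` and `τ` differ. -/
def strictPoints (τ : TopologicalSpace ℝ) : Set ℝ :=
  {x : ℝ | @nhds ℝ euclideanTopology x ≠ @nhds ℝ τ x}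

/-- The spaces `(X, τ)`, `τ ∈ 𝓕`, are incomparable: for `σ, τ ∈ 𝓕` the space `(X, σ)` is
homeomorphic to a subspace `S` of `(X, τ)` only in the trivial case `(X, σ) = S = (X, τ)`. -/
def Incomparable {X : Type*} (𝓕 : Set (TopologicalSpace X)) : Prop :=
  ∀ σ ∈ 𝓕, ∀ τ ∈ 𝓕, ∀ S : Set X,
    Nonempty (@Homeomorph X S σ (TopologicalSpace.induced ((↑) : S → X) τ)) →
      σ = τ ∧ S = Set.univ

open Set Filter Cardinal Topology

/-! Each topology is that of the graph of a wild function `f`, carried to the line by projection. If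
the graph meets every closed planar set whose projection contains an interval, it is connected and
`f` is nowhere continuous; as a subspace of the plane it is separable and metrizable. There are only
`𝔠` closed sets and `𝔠` sequences coding continuous maps between graphs, so one recursion of length
`𝔠` meets every closed set in question and defeats every map moving too many abscissae
(`exists_rigid_family`). It leaves `𝔠` abscissae free, hence `2 ^ 𝔠` extensions. Embeddings between
their graphs fix abscissae (`RigidFamily.embedding_eq`), which yields incomparability. -/

/-! ### A transfinite selection principle -/

/-- Sets `supp d` of fewer than `𝔠` points can be made pairwise disjoint along a transfinite
construction of length `𝔠`, each choice being made relative to the set of points used before. -/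
theorem exists_transfinite_selection {I D : Type} [Nonempty D] (hI : #I = 𝔠) (supp : D → Set ℝ)
    (hsupp : ∀ d, (supp d).Finite) (P : I → Set ℝ → D → Prop)
    (hP : ∀ i (X : Set ℝ), #X < 𝔠 → ∃ d, Disjoint (supp d) X ∧ P i X d) :
    ∃ d : I → D, (∀ i j, i ≠ j → Disjoint (supp (d i)) (supp (d j))) ∧
      ∀ i, ∃ X : Set ℝ, #X < 𝔠 ∧ P i X (d i) := by
  classical
  -- A well-order of least possible type: proper initial segments have fewer than `𝔠` elements.
  obtain ⟨r, wo, hr⟩ := Cardinal.exists_ord_eq I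
  have hlt : ∀ i, #{j // r j i} < 𝔠 := fun i => by
    rw [← Ordinal.card_typein (r := r) i, ← hI]
    exact card_typein_lt i hr
  have small : ∀ i (e : {j // r j i} → D), #(⋃ j, supp (e j) : Set ℝ) < 𝔠 := by
    intro i e
    rcases lt_or_ge (#{j // r j i}) ℵ₀ with h | h
    · have : Finite {j // r j i} := lt_aleph0_iff_finite.1 h
      exact (lt_aleph0_iff_finite.2 (Set.finite_iUnion fun j => hsupp (e j))).trans
        aleph0_lt_continuum
    · calc #(⋃ j, supp (e j) : Set ℝ)
          ≤ #{j // r j i} * ⨆ j, #(supp (e j)) := mk_iUnion_le _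
        _ ≤ #{j // r j i} * ℵ₀ := by
            gcongr
            exact ciSup_le' fun j => (lt_aleph0_iff_finite.2 (hsupp (e j))).le
        _ = #{j // r j i} := mul_aleph0_eq h
        _ < 𝔠 := hlt i
  choose! next hnext using hP
  have wf : WellFounded r := wo.wf
  let d : I → D := wf.fix fun i e => next i (⋃ j : {j // r j i}, supp (e j.1 j.2))
  have hd : ∀ i, d i = next i (⋃ j : {j // r j i}, supp (d j.1)) := fun i => wf.fix_eq _ i
  have key : ∀ i, Disjoint (supp (d i)) (⋃ j : {j // r j i}, supp (d j.1)) ∧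
      P i (⋃ j : {j // r j i}, supp (d j.1)) (d i) := fun i => by
    have := hnext i _ (small i fun j => d j.1)
    rwa [← hd i] at this
  have below : ∀ i j, r j i → Disjoint (supp (d i)) (supp (d j)) := fun i j h =>
    (key i).1.mono_right (Set.subset_iUnion (fun j : {j // r j i} => supp (d j.1)) ⟨j, h⟩)
  refine ⟨d, fun i j hij => ?_, fun i => ⟨_, small i fun j => d j.1, (key i).2⟩⟩
  rcases trichotomous_of r i j with h | h | h
  · exact (below j i h).symm
  · exact absurd h hij
  · exact below i j h

/-- Fewer than `𝔠` reals never exhaust the line. -/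
theorem exists_notMem_of_mk_lt {X : Set ℝ} (hX : #X < 𝔠) : ∃ x, x ∉ X := by
  by_contra! h
  rw [Set.eq_univ_of_forall h, mk_univ, mk_real] at hX
  exact lt_irrefl _ hX

theorem mk_insert_lt_continuum {X : Set ℝ} (hX : #X < 𝔠) (x : ℝ) : #(insert x X : Set ℝ) < 𝔠 :=
  mk_insert_le.trans_lt
    (add_lt_of_lt aleph0_le_continuum hX (one_lt_aleph0.trans aleph0_lt_continuum))

/-- Given `𝔠` sets `R i` of pairs of points of the plane, a function on the line can be fixed off a
set `Z` of size `𝔠` in such a way that its graph contains both points of a pair from each `R i`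
for which this is not excluded by the choice of abscissae. -/
theorem exists_partial_function {I : Type} (hI : #I = 𝔠) (R : I → Set ((ℝ × ℝ) × (ℝ × ℝ))) :
    ∃ (f₀ : ℝ → ℝ) (Z : Set ℝ), #Z = 𝔠 ∧ ∀ i, ∃ X : Set ℝ, #X < 𝔠 ∧
      ((∃ p q, (p, q) ∈ R i ∧ p.1 ∉ Z ∧ q.1 ∉ Z ∧ f₀ p.1 = p.2 ∧ f₀ q.1 = q.2) ∨
        ∀ p q, (p, q) ∈ R i → p.1 ∈ X ∨ q.1 ∈ X ∨ p.1 = q.1) := by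
  -- Each stage picks two points to put on the graph and a spare abscissa, which goes into `Z`.
  obtain ⟨d, hdisj, hd⟩ := exists_transfinite_selection (D := (ℝ × ℝ) × (ℝ × ℝ) × ℝ) hI
    (fun d => {d.1.1, d.2.1.1, d.2.2}) (fun d => Set.toFinite _)
    (fun i X d => (d.1.1 ≠ d.2.1.1 ∧ d.2.2 ≠ d.1.1 ∧ d.2.2 ≠ d.2.1.1) ∧
      ((∃ p q, (p, q) ∈ R i ∧ p.1 ∉ X ∧ q.1 ∉ X ∧ p.1 ≠ q.1) → (d.1, d.2.1) ∈ R i)) (by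
      intro i X hX
      obtain ⟨p, q, hpX, hqX, hpq, hR⟩ : ∃ p q : ℝ × ℝ, p.1 ∉ X ∧ q.1 ∉ X ∧ p.1 ≠ q.1 ∧
          ((∃ p q, (p, q) ∈ R i ∧ p.1 ∉ X ∧ q.1 ∉ X ∧ p.1 ≠ q.1) → (p, q) ∈ R i) := by
        by_cases h : ∃ p q, (p, q) ∈ R i ∧ p.1 ∉ X ∧ q.1 ∉ X ∧ p.1 ≠ q.1
        · obtain ⟨p, q, h1, h2, h3, h4⟩ := h
          exact ⟨p, q, h2, h3, h4, fun _ => h1⟩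
        -- No admissible pair is left, so dummy points are taken.
        · obtain ⟨x, hx⟩ := exists_notMem_of_mk_lt hX
          obtain ⟨y, hy⟩ := exists_notMem_of_mk_lt (mk_insert_lt_continuum hX x)
          rw [Set.mem_insert_iff, not_or] at hy
          exact ⟨(x, 0), (y, 0), hx, hy.2, fun e => hy.1 e.symm, fun h' => absurd h' h⟩
      obtain ⟨z, hz⟩ := exists_notMem_of_mk_lt
        (mk_insert_lt_continuum (mk_insert_lt_continuum hX p.1) q.1)
      simp only [Set.mem_insert_iff, not_or] at hz
      refine ⟨(p, q, z), ?_, ⟨hpq, hz.2.1, hz.1⟩, hR⟩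
      rw [Set.disjoint_left]
      rintro a (rfl | rfl | rfl)
      exacts [hpX, hqX, hz.2.2])
  choose X hX hne hR using hd
  have inj_of : ∀ {i j a}, a ∈ ({(d i).1.1, (d i).2.1.1, (d i).2.2} : Set ℝ) →
      a ∈ ({(d j).1.1, (d j).2.1.1, (d j).2.2} : Set ℝ) → i = j := fun {i j a} h1 h2 => by
    by_contra hij
    exact Set.disjoint_left.1 (hdisj i j hij) h1 h2
  let pt : I × Bool → ℝ × ℝ := fun k => bif k.2 then (d k.1).1 else (d k.1).2.1
  have pt_mem : ∀ k, (pt k).1 ∈ ({(d k.1).1.1, (d k.1).2.1.1, (d k.1).2.2} : Set ℝ) := by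
    rintro ⟨i, _ | _⟩
    exacts [Or.inr (Or.inl rfl), Or.inl rfl]
  have pt_inj : Function.Injective fun k => (pt k).1 := by
    rintro ⟨i, b⟩ ⟨j, c⟩ h
    obtain rfl : i = j := inj_of (pt_mem (i, b)) (by rw [show (pt (i, b)).1 = _ from h]; exact pt_mem _)
    rcases b with _ | _ <;> rcases c with _ | _
    exacts [rfl, absurd (Eq.symm h) (hne i).1, absurd h (hne i).1, rfl]
  have hZ : ∀ k, (pt k).1 ∉ Set.range fun i => (d i).2.2 := by
    rintro ⟨i, b⟩ ⟨j, hj⟩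
    obtain rfl : j = i := inj_of (a := (d j).2.2) (Or.inr (Or.inr rfl))
      (by rw [show (d j).2.2 = _ from hj]; exact pt_mem _)
    rcases b with _ | _
    · exact (hne j).2.2 hj
    · exact (hne j).2.1 hj
  have ext : ∀ k, Function.extend (fun k => (pt k).1) (fun k => (pt k).2) 0 (pt k).1 = (pt k).2 :=
    fun k => pt_inj.extend_apply _ _ k
  refine ⟨Function.extend (fun k => (pt k).1) (fun k => (pt k).2) 0, Set.range fun i => (d i).2.2,
    ?_, fun i => ⟨X i, hX i, ?_⟩⟩
  · rw [← hI]
    exact mk_range_eq _ fun i j h => inj_of (a := (d i).2.2) (Or.inr (Or.inr rfl))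
      (by rw [show (d i).2.2 = _ from h]; exact Or.inr (Or.inr rfl))
  · by_cases h : ∃ p q, (p, q) ∈ R i ∧ p.1 ∉ X i ∧ q.1 ∉ X i ∧ p.1 ≠ q.1
    · exact Or.inl ⟨_, _, hR i h, hZ (i, true), hZ (i, false), ext (i, true), ext (i, false)⟩
    · right
      push Not at h
      intro p q hpq
      by_contra! h'
      exact h'.2.2 (h p q hpq h'.1 h'.2.1)

/-! ### The line with the topology of a graph -/

/-- The real line, to be topologized as the graph of `f`. -/
def GraphLine (_f : ℝ → ℝ) : Type := ℝ

namespace GraphLine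

/-- The parametrization of the graph. -/
def toPlane (f : ℝ → ℝ) (x : GraphLine f) : ℝ × ℝ := ((x : ℝ), f x)

instance (f : ℝ → ℝ) : TopologicalSpace (GraphLine f) :=
  TopologicalSpace.induced (toPlane f) inferInstance

instance (f : ℝ → ℝ) : Nonempty (GraphLine f) := ⟨(0 : ℝ)⟩

variable {f : ℝ → ℝ}

theorem isEmbedding_toPlane : IsEmbedding (toPlane f) :=
  ⟨⟨rfl⟩, fun _ _ h => congrArg Prod.fst h⟩

instance : TopologicalSpace.MetrizableSpace (GraphLine f) :=
  isEmbedding_toPlane.metrizableSpace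

instance : SecondCountableTopology (GraphLine f) :=
  isEmbedding_toPlane.isInducing.secondCountableTopology

/-- The identity map onto the Euclidean line. -/
def toReal (x : GraphLine f) : ℝ := x

theorem continuous_toReal : Continuous (toReal : GraphLine f → ℝ) :=
  continuous_fst.comp isEmbedding_toPlane.continuous

theorem continuous_apply : Continuous fun x : GraphLine f => f x.toReal :=
  continuous_snd.comp isEmbedding_toPlane.continuous

end GraphLine

/-- The graph of `f` meets every closed subset of the plane whose projection to the first axis
contains an interval. -/
def MeetsWideClosedSets (f : ℝ → ℝ) : Prop :=
  ∀ K : Set (ℝ × ℝ), IsClosed K → ∀ a b, a < b → Set.Ioo a b ⊆ Prod.fst '' K → ∃ x, (x, f x) ∈ K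


theorem MeetsWideClosedSets.exists_mem_of_isOpen {f : ℝ → ℝ} (hf : MeetsWideClosedSets f)
    {U : Set (ℝ × ℝ)} (hU : IsOpen U) (hne : U.Nonempty) : ∃ x, (x, f x) ∈ U := by
  obtain ⟨⟨a, b⟩, hab⟩ := hne
  obtain ⟨ε, hε, hball⟩ := Metric.nhds_basis_closedBall.mem_iff.1 (hU.mem_nhds hab)
  obtain ⟨x, hx⟩ := hf (Metric.closedBall (a, b) ε) Metric.isClosed_closedBall (a - ε) (a + ε)
    (by linarith) fun x hx => ⟨(x, b), by
      rw [← Real.ball_eq_Ioo] at hx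
      rw [← closedBall_prod_same]
      exact ⟨Metric.ball_subset_closedBall hx, Metric.mem_closedBall_self hε.le⟩, rfl⟩
  exact ⟨x, hball hx⟩

/-- Every nonempty open set of the graph has `𝔠` points. -/
theorem MeetsWideClosedSets.mk_eq_of_isOpen {f : ℝ → ℝ} (hf : MeetsWideClosedSets f)
    {V : Set (GraphLine f)} (hV : IsOpen V) (hne : V.Nonempty) : 𝔠 ≤ #V := by
  obtain ⟨U, hU, rfl⟩ := GraphLine.isEmbedding_toPlane.isOpen_iff.1 hV
  obtain ⟨x, hx⟩ := hne
  obtain ⟨ε, hε, hball⟩ := Metric.nhds_basis_closedBall.mem_iff.1 (hU.mem_nhds hx)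
  change ℝ at x
  change Metric.closedBall (x, f x) ε ⊆ U at hball
  rw [← closedBall_prod_same] at hball
  have key : ∀ y ∈ Metric.closedBall (f x) ε, ∃ z : ℝ, (z, f z) ∈ U ∧ f z = y := by
    intro y hy
    obtain ⟨z, hz⟩ := hf (Metric.closedBall x ε ×ˢ {y})
      (Metric.isClosed_closedBall.prod isClosed_singleton) (x - ε) (x + ε)
      (by linarith) fun z hz => ⟨(z, y), ⟨by
        rw [← Real.ball_eq_Ioo] at hz
        exact Metric.ball_subset_closedBall hz, rfl⟩, rfl⟩
    exact ⟨z, hball ⟨hz.1, by rw [show f z = y from hz.2]; exact hy⟩, hz.2⟩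
  choose! z hzU hz using key
  calc 𝔠 = #(Metric.closedBall (f x) ε) := by
        rw [Real.closedBall_eq_Icc, mk_Icc_real (by linarith)]
    _ ≤ #(GraphLine.toPlane f ⁻¹' U) :=
        mk_le_of_injective (f := fun y => ⟨z y.1, hzU y.1 y.2⟩) fun y y' h => by
          have h' : z y.1 = z y'.1 := congrArg Subtype.val h
          exact Subtype.ext (by rw [← hz _ y.2, ← hz _ y'.2, h'])

/-- The graph is dense, so `U` and `V` are disjoint, and a vertical line inside `U ∪ V` lies in one
of them. If `(c, f c) ∈ V` with `c` close to `x`, such a line close to `c` would meet both `V`, at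
height `f c`, and `U`, at height `f x`. -/
theorem MeetsWideClosedSets.isOpen_setOf {f : ℝ → ℝ} (hf : MeetsWideClosedSets f)
    {U V : Set (ℝ × ℝ)} (hU : IsOpen U) (hV : IsOpen V) (hcov : ∀ x, (x, f x) ∈ U ∪ V)
    (hdisj : ∀ x, (x, f x) ∉ U ∩ V) : IsOpen {x | (x, f x) ∈ U} := by
  have hUV : ¬(U ∩ V).Nonempty := fun h => by
    obtain ⟨x, hx⟩ := hf.exists_mem_of_isOpen (hU.inter hV) h
    exact hdisj x hx
  -- in every interval there is a vertical line inside `U ∪ V`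
  have hline : ∀ a b : ℝ, a < b → ∃ c ∈ Set.Ioo a b, ∀ y, (c, y) ∈ U ∪ V := by
    intro a b hab
    by_contra! h
    obtain ⟨x, hx⟩ := hf (U ∪ V)ᶜ (hU.union hV).isClosed_compl a b hab fun c hc => by
      obtain ⟨y, hy⟩ := h c hc
      exact ⟨(c, y), hy, rfl⟩
    exact hx (hcov x)
  have hnot : ∀ c, (∀ y, (c, y) ∈ U ∪ V) → ∀ y y', (c, y) ∈ U → (c, y') ∉ V := by
    intro c hc y y' hy hy'
    obtain ⟨z, -, hz⟩ := (isPreconnected_univ (α := ℝ)) ((fun y => (c, y)) ⁻¹' U)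
      ((fun y => (c, y)) ⁻¹' V) (hU.preimage (by fun_prop)) (hV.preimage (by fun_prop))
      (fun y _ => hc y) ⟨y, trivial, hy⟩ ⟨y', trivial, hy'⟩
    exact hUV ⟨_, hz⟩
  rw [Metric.isOpen_iff]
  intro x hx
  obtain ⟨ε, hε, hball⟩ := Metric.isOpen_iff.1 hU _ hx
  refine ⟨ε, hε, fun c hc => ?_⟩
  by_contra hcU
  have hcV : (c, f c) ∈ V := (hcov c).resolve_left hcU
  obtain ⟨δ, hδ, hball'⟩ := Metric.isOpen_iff.1 (hV.inter
    (Metric.isOpen_ball.preimage continuous_fst)) (c, f c) ⟨hcV, hc⟩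
  obtain ⟨e, he, hline⟩ := hline (c - δ) (c + δ) (by linarith)
  rw [← Real.ball_eq_Ioo] at he
  rw [← ball_prod_same] at hball hball'
  have h1 := hball' (a := (e, f c)) ⟨he, Metric.mem_ball_self hδ⟩
  exact hnot e hline _ _ (hball (a := (e, f x)) ⟨h1.2, Metric.mem_ball_self hε⟩) h1.1

/-- A clopen subset of the graph projects to a Euclidean clopen set, and the Euclidean line is
connected. -/
theorem MeetsWideClosedSets.connectedSpace {f : ℝ → ℝ} (hf : MeetsWideClosedSets f) :
    ConnectedSpace (GraphLine f) := by
  have : PreconnectedSpace (GraphLine f) := by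
    rw [preconnectedSpace_iff_clopen]
    intro s hs
    obtain ⟨U, hU, hUs⟩ := GraphLine.isEmbedding_toPlane.isOpen_iff.1 hs.isOpen
    obtain ⟨V, hV, hVs⟩ := GraphLine.isEmbedding_toPlane.isOpen_iff.1 hs.compl.isOpen
    have memU : ∀ x : ℝ, (x, f x) ∈ U ↔ (show GraphLine f from x) ∈ s := fun x => by
      rw [← hUs]; rfl
    have memV : ∀ x : ℝ, (x, f x) ∈ V ↔ (show GraphLine f from x) ∉ s := fun x => by
      rw [← Set.mem_compl_iff, ← hVs]; rfl
    have hcov : ∀ x, (x, f x) ∈ U ∪ V := fun x => by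
      rw [Set.mem_union, memU, memV]; exact em _
    have hdisj : ∀ x, (x, f x) ∉ U ∩ V := fun x => by
      rw [Set.mem_inter_iff, memU, memV]; exact fun h => h.2 h.1
    have h1 := hf.isOpen_setOf hU hV hcov hdisj
    have h2 := hf.isOpen_setOf hV hU (fun x => Or.symm (hcov x)) fun x h => hdisj x ⟨h.2, h.1⟩
    have hc : IsClopen {x | (x, f x) ∈ U} := by
      refine ⟨⟨?_⟩, h1⟩
      convert h2 using 1
      ext x
      exact (not_congr (memU x)).trans (memV x).symm
    rcases isClopen_iff.1 hc with h | h
    · left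
      exact Set.eq_empty_of_forall_notMem fun x hx =>
        (h ▸ (memU x).2 hx : (x : ℝ) ∈ (∅ : Set ℝ))
    · right
      exact Set.eq_univ_of_forall fun x => (memU x).1 (h.symm ▸ Set.mem_univ (x : ℝ) :)
  exact ⟨inferInstance⟩

theorem MeetsWideClosedSets.not_continuousAt {f : ℝ → ℝ} (hf : MeetsWideClosedSets f) (x : ℝ) :
    ¬ContinuousAt f x := by
  intro h
  obtain ⟨δ, hδ, hball⟩ := Metric.continuousAt_iff.1 h 1 one_pos
  obtain ⟨y, hy⟩ := hf.exists_mem_of_isOpen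
    (Metric.isOpen_ball.prod Metric.isOpen_ball : IsOpen (Metric.ball x δ ×ˢ Metric.ball (f x + 3) 1))
    ⟨(x, f x + 3), Metric.mem_ball_self hδ, Metric.mem_ball_self one_pos⟩
  have h1 := hball hy.1
  have h2 : dist (f y) (f x + 3) < 1 := hy.2
  rw [Real.dist_eq, abs_lt] at h1 h2
  linarith [h1.2, h2.1]

/-! ### Rigidity -/

/-- The pairs of a point `p` and a point `q` excluded from any graph that contains the limit of `v`
along `d → p`, in the sense that `q` lies above the same abscissa as the limit but differs from it. -/
def excludedPairs (c : ℕ → (ℝ × ℝ) × (ℝ × ℝ)) : Set ((ℝ × ℝ) × (ℝ × ℝ)) :=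
  {pq | ∃ y, Tendsto (fun n => (c n).2) (comap (fun n => (c n).1) (𝓝 pq.1)) (𝓝 y) ∧
    y.1 = pq.2.1 ∧ y.2 ≠ pq.2.2}

/-- A family of functions with rigid graphs: a self-map of the plane continuous on a graph and
prescribed on a dense sequence either fails to map graphs of the family into each other, or moves
abscissae only inside a set of fewer than `𝔠` points. -/
def RigidFamily (𝒢 : Set (ℝ → ℝ)) : Prop :=
  ∀ c : ℕ → (ℝ × ℝ) × (ℝ × ℝ), ∃ X : Set ℝ, #X < 𝔠 ∧
    ((∃ p q, (p, q) ∈ excludedPairs c ∧ ∀ f ∈ 𝒢, f p.1 = p.2 ∧ f q.1 = q.2) ∨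
      ∀ p q, (p, q) ∈ excludedPairs c → p.1 ∈ X ∨ q.1 ∈ X ∨ p.1 = q.1)

/-- There is a partial function all of whose extensions have rigid graphs meeting all wide closed
sets, with `𝔠` points left free. -/
theorem exists_rigid_family : ∃ (f₀ : ℝ → ℝ) (Z : Set ℝ), #Z = 𝔠 ∧
    (∀ f, Set.EqOn f f₀ Zᶜ → MeetsWideClosedSets f) ∧ RigidFamily {f | Set.EqOn f f₀ Zᶜ} := by
  have hC : #(ℕ → (ℝ × ℝ) × (ℝ × ℝ)) = 𝔠 := by simp [mk_real]
  have hD : #(ℕ → ℝ × ℝ) = 𝔠 := by simp [mk_real]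
  obtain ⟨f₀, Z, hZ, H⟩ := exists_partial_function
    (I := (ℕ → ℝ × ℝ) ⊕ (ℕ → (ℝ × ℝ) × (ℝ × ℝ))) (by simp [hC, hD])
    (Sum.elim (fun d => {pq | pq.1 ∈ closure (Set.range d)}) excludedPairs)
  refine ⟨f₀, Z, hZ, fun f hf K hK a b hab hKab => ?_, fun c => ?_⟩
  · have hne : K.Nonempty := by
      obtain ⟨x, hx⟩ := Set.nonempty_Ioo.2 hab
      obtain ⟨p, hp, -⟩ := hKab hx
      exact ⟨p, hp⟩
    -- A closed set is coded by a dense sequence in it.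
    have : Nonempty K := hne.to_subtype
    have hd : closure (Set.range fun n => (TopologicalSpace.denseSeq K n : ℝ × ℝ)) = K := by
      refine (closure_minimal (Set.range_subset_iff.2 fun n => Subtype.coe_prop _) hK).antisymm ?_
      have h := Subtype.dense_iff.1 (TopologicalSpace.denseRange_denseSeq K)
      rwa [← Set.range_comp] at h
    obtain ⟨X, hX, ⟨p, q, hpq, hp, -, hfp, -⟩ | h⟩ :=
      H (Sum.inl fun n => (TopologicalSpace.denseSeq K n : ℝ × ℝ))
    · have hpK : p ∈ K := hd ▸ (show p ∈ closure _ from hpq)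
      refine ⟨p.1, ?_⟩
      rw [hf hp, hfp]
      exact hpK
    · exfalso
      refine (lt_of_le_of_lt (mk_le_mk_of_subset fun x hx => ?_) hX).ne (mk_Ioo_real hab)
      obtain ⟨p, hp, rfl⟩ := hKab hx
      obtain ⟨y, hy⟩ := exists_notMem_of_mk_lt (mk_insert_lt_continuum hX p.1)
      rw [Set.mem_insert_iff, not_or] at hy
      rcases h p (y, 0) (show p ∈ closure _ by rw [hd]; exact hp) with h | h | h
      exacts [h, absurd h hy.2, absurd h.symm hy.1]
  · obtain ⟨X, hX, ⟨p, q, hpq, hp, hq, hfp, hfq⟩ | h⟩ := H (Sum.inr c)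
    · exact ⟨X, hX, Or.inl ⟨p, q, hpq, fun f hf => ⟨(hf hp).trans hfp, (hf hq).trans hfq⟩⟩⟩
    · exact ⟨X, hX, Or.inr h⟩

/-- Embeddings between the graphs of a rigid family are identities. -/
theorem RigidFamily.embedding_eq {𝒢 : Set (ℝ → ℝ)} (h𝒢 : RigidFamily 𝒢) {f g : ℝ → ℝ} (hf : f ∈ 𝒢)
    (hg : g ∈ 𝒢) (hfK : MeetsWideClosedSets f) {u : GraphLine f → GraphLine g}
    (hu : IsEmbedding u) (x : GraphLine f) : (u x).toReal = x.toReal := by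
  let e := TopologicalSpace.denseSeq (GraphLine f)
  have he : DenseRange e := TopologicalSpace.denseRange_denseSeq _
  let c : ℕ → (ℝ × ℝ) × (ℝ × ℝ) := fun n => (GraphLine.toPlane f (e n), GraphLine.toPlane g (u (e n)))
  have hcomap : ∀ x, comap (fun n => (c n).1) (𝓝 (GraphLine.toPlane f x)) = comap e (𝓝 x) := by
    intro x
    rw [GraphLine.isEmbedding_toPlane.isInducing.nhds_eq_comap, comap_comap]
    rfl
  have hbot : ∀ x, (comap e (𝓝 x)).NeBot := fun x => by
    rw [comap_neBot_iff]
    intro t ht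
    exact he.exists_mem_open isOpen_interior ⟨x, mem_interior_iff_mem_nhds.2 ht⟩ |>.imp
      fun _ h => interior_subset h
  have hlim : ∀ x, Tendsto (fun n => (c n).2) (comap (fun n => (c n).1) (𝓝 (GraphLine.toPlane f x)))
      (𝓝 (GraphLine.toPlane g (u x))) := fun x => by
    rw [hcomap]
    exact ((GraphLine.isEmbedding_toPlane.continuous.comp hu.continuous).tendsto x).comp
      tendsto_comap
  obtain ⟨X, hX, ⟨p, q, ⟨y, hy, hyq, hne⟩, hpq⟩ | h⟩ := h𝒢 c
  · exfalso
    have hp : GraphLine.toPlane f (show GraphLine f from p.1) = p := Prod.ext rfl (hpq f hf).1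
    have hlimp := hlim (show GraphLine f from p.1)
    have hbotp := hbot (show GraphLine f from p.1)
    rw [← hcomap, hp] at hbotp
    rw [hp] at hlimp
    -- The limit is the point `u p` of the graph of `g`, so it cannot differ from `q` over the same
    -- abscissa.
    obtain rfl := tendsto_nhds_unique hy hlimp
    apply hne
    rw [← (hpq g hg).2, ← hyq]
    rfl
  · by_contra hx
    have hopen : IsOpen {x : GraphLine f | (u x).toReal ≠ x.toReal} :=
      isOpen_ne_fun (GraphLine.continuous_toReal.comp hu.continuous) GraphLine.continuous_toReal
    refine (hfK.mk_eq_of_isOpen hopen ⟨x, hx⟩).not_gt ?_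
    -- Each moved point lies in `X` or is sent into it; by injectivity there are fewer than `𝔠` of
    -- them, too few for a nonempty open set.
    let w : GraphLine f → ℝ := fun x => (u x).toReal
    have hw : Function.Injective w := hu.injective
    have hsub : {x : GraphLine f | (u x).toReal ≠ x.toReal} ⊆ (X ∪ w ⁻¹' X : Set ℝ) := by
      intro x hx
      -- Adding `1` gives a point off the graph of `g`, over the abscissa of `u x`.
      rcases h (GraphLine.toPlane f x) ((u x).toReal, g (u x).toReal + 1)
        ⟨_, hlim x, rfl, (lt_add_one _).ne⟩ with h | h | h
      exacts [Or.inl h, Or.inr h, absurd h.symm hx]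
    exact (mk_le_mk_of_subset hsub).trans_lt <| (mk_union_le _ _).trans_lt <|
      add_lt_of_lt aleph0_le_continuum hX ((mk_preimage_of_injective w X hw).trans_lt hX)

/-! ### The topologies -/

/-- The topology on the line induced from the graph of `f`. -/
abbrev graphTopology (f : ℝ → ℝ) : TopologicalSpace ℝ :=
  inferInstanceAs (TopologicalSpace (GraphLine f))

theorem refinesEuclidean_graphTopology (f : ℝ → ℝ) : RefinesEuclidean (graphTopology f) :=
  fun _ hU => hU.preimage (GraphLine.continuous_toReal (f := f))

theorem MeetsWideClosedSets.strictPoints_eq {f : ℝ → ℝ} (hf : MeetsWideClosedSets f) :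
    strictPoints (graphTopology f) = Set.univ := by
  refine Set.eq_univ_of_forall fun x h => hf.not_continuousAt x ?_
  have : Tendsto f (@nhds ℝ (graphTopology f) x) (𝓝 (f x)) :=
    (GraphLine.continuous_apply (f := f)).tendsto x
  rwa [← h] at this

theorem RigidFamily.incomparable {𝒢 : Set (ℝ → ℝ)} (h𝒢 : RigidFamily 𝒢)
    (hK : ∀ f ∈ 𝒢, MeetsWideClosedSets f) : Incomparable (graphTopology '' 𝒢) := by
  rintro _ ⟨f, hf, rfl⟩ _ ⟨g, hg, rfl⟩ S ⟨h⟩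
  let _ : TopologicalSpace S := TopologicalSpace.induced ((↑) : S → ℝ) (graphTopology g)
  let h' : GraphLine f ≃ₜ S := h
  let u : GraphLine f → GraphLine g := fun x => (h' x : ℝ)
  have hu : IsEmbedding u :=
    (⟨⟨rfl⟩, Subtype.val_injective⟩ : IsEmbedding (fun s : S => (show GraphLine g from s.1))).comp
      h'.isEmbedding
  have hid : ∀ x : ℝ, u x = x := h𝒢.embedding_eq hf hg (hK f hf) hu
  constructor
  · have h1 := hu.eq_induced
    have h2 : (u : ℝ → ℝ) = id := funext hid
    change graphTopology f = TopologicalSpace.induced (u : ℝ → ℝ) (graphTopology g) at h1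
    rw [h2] at h1
    exact h1.trans (@induced_id ℝ (graphTopology g))
  · refine Set.eq_univ_of_forall fun x => ?_
    have : u x ∈ S := (h' x).2
    rwa [hid x] at this

/-- At most `𝔠` functions have a given graph topology. -/
theorem mk_graphTopology_fiber_le (T : TopologicalSpace ℝ) : #{f | graphTopology f = T} ≤ 𝔠 := by
  rcases Set.eq_empty_or_nonempty {f | graphTopology f = T} with h | ⟨g, rfl⟩
  · rw [h]; simp
  -- Each `f` is continuous for its own graph topology, hence determined by its values on a
  -- countable dense set.
  let e := TopologicalSpace.denseSeq (GraphLine g)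
  calc #{f | graphTopology f = graphTopology g} ≤ #(ℕ → ℝ) := by
        refine mk_le_of_injective (f := fun f n => f.1 (e n).toReal) ?_
        have hc : ∀ f : {f | graphTopology f = graphTopology g},
            Continuous fun x : GraphLine g => f.1 x.toReal := by
          rintro ⟨f, hf⟩
          have h1 : @Continuous ℝ ℝ (graphTopology f) _ f := GraphLine.continuous_apply (f := f)
          rw [show graphTopology f = _ from hf] at h1
          exact h1
        intro f f' hff'
        have := (TopologicalSpace.denseRange_denseSeq (GraphLine g)).equalizer (hc f) (hc f') hff'
        exact Subtype.ext this
    _ = 𝔠 := by simp [mk_real]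

/-- The `2 ^ 𝔠` extensions fall into classes of at most `𝔠` with the same topology, so fewer than `2
^ 𝔠` topologies cannot suffice. -/
theorem mk_image_graphTopology {f₀ : ℝ → ℝ} {Z : Set ℝ} (hZ : #Z = 𝔠) :
    #(graphTopology '' {f | Set.EqOn f f₀ Zᶜ}) = 2 ^ 𝔠 := by
  classical
  have hall : #(ℝ → ℝ) = 2 ^ 𝔠 := by rw [← power_def, mk_real, power_self_eq aleph0_le_continuum]
  have hext : 2 ^ 𝔠 ≤ #{f | Set.EqOn f f₀ Zᶜ} := by
    have : #(Set Z) = 2 ^ 𝔠 := by rw [mk_set, hZ]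
    rw [← this]
    refine mk_le_of_injective (f := fun s : Set Z =>
      ⟨fun x => if h : x ∈ Z then (if ⟨x, h⟩ ∈ s then 1 else 0) else f₀ x,
        fun x hx => dif_neg hx⟩) fun s t hst => ?_
    ext ⟨x, hx⟩
    have := congrFun (congrArg Subtype.val hst) x
    by_cases h1 : (⟨x, hx⟩ : Z) ∈ s <;> by_cases h2 : (⟨x, hx⟩ : Z) ∈ t <;> simp_all
  refine le_antisymm (mk_image_le.trans ((mk_set_le _).trans hall.le)) ?_
  by_contra! hlt
  have hmul : #{f | Set.EqOn f f₀ Zᶜ} ≤ #(graphTopology '' {f | Set.EqOn f f₀ Zᶜ}) * 𝔠 := by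
    refine mk_le_mk_mul_of_mk_preimage_le
      (fun f => ⟨graphTopology f.1, f.1, f.2, rfl⟩) fun T => ?_
    refine le_trans ?_ (mk_graphTopology_fiber_le T.1)
    exact mk_le_of_injective (f := fun f => ⟨f.1.1, congrArg Subtype.val f.2⟩) fun f f' h =>
      Subtype.ext (Subtype.ext (congrArg (fun f => f.1) h))
  exact (hext.trans hmul).not_gt
    (mul_lt_of_lt (aleph0_le_continuum.trans (cantor 𝔠).le) hlt (cantor 𝔠))

theorem corollary1 :
    ∃ 𝓕 : Set (TopologicalSpace ℝ),
      Cardinal.mk 𝓕 = 2 ^ Cardinal.continuum ∧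
      Incomparable 𝓕 ∧
      ∀ τ ∈ 𝓕,
        RefinesEuclidean τ ∧
        strictPoints τ = Set.univ ∧
        @ConnectedSpace ℝ τ ∧
        @TopologicalSpace.SeparableSpace ℝ τ ∧
        @TopologicalSpace.MetrizableSpace ℝ τ := by
  obtain ⟨f₀, Z, hZ, hK, hR⟩ := exists_rigid_family
  refine ⟨graphTopology '' {f | Set.EqOn f f₀ Zᶜ}, mk_image_graphTopology hZ,
    hR.incomparable hK, ?_⟩
  rintro _ ⟨f, hf, rfl⟩
  exact ⟨refinesEuclidean_graphTopology f, (hK f hf).strictPoints_eq, (hK f hf).connectedSpace,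
    inferInstanceAs (TopologicalSpace.SeparableSpace (GraphLine f)),
    inferInstanceAs (TopologicalSpace.MetrizableSpace (GraphLine f))⟩
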